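/- Let $q\in\mathbb{C}$ with $0<|q|<1$. Write $(a;q)_n=\prod_{i=0}^{n-1}(1-aq^i)$, $(a;q)_\infty=\prod_{i=0}^{\infty}(1-aq^i)$, and $[n]_q=\frac{1-q^n}{1-q}$ for $n\in\mathbb{Z}$. Then $$\sum_{k=0}^{\infty}\frac{P_1\, q^{k^2-4}}{(1-q)^2[2k-1]_q[4k-2]_q}\cdot\frac{(q;q^2)_k^2(q^2;q^4)_k}{(q^4;q^4)_k^3}=\frac{(q^2;q^4)_\infty(q^6;q^4)_\infty}{(q^4;q^4)_\infty^2},$$ where $P_1=-q^2+q^{4k+2}+q^{6k+3}+q^{8k}-q^{8k+2}-q^{10k+1}$, and $$\sum_{k=0}^{\infty}\frac{P_2\, q^{k^2-7}(1+q)}{(1-q)^2[2k-1]_q^2[4k-2]_q}\cdot\frac{(q;q^2)_k^2(q^2;q^4)_k}{(q^4;q^4)_k^3}=\frac{(q^2;q^4)_\infty(q^6;q^4)_\infty}{(q^4;q^4)_\infty^2},$$ where $P_2=q^3-q^{4k+3}-q^{6k+4}-2q^{8k+1}+2q^{8k+3}+q^{10k}$; both series converge absolutely. These identities are $q$-analogues,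 respectively, of Sun's identities $$\sum_{k=0}^{\infty}\frac{(12k^2-1)\binom{2k}{k}^3}{(2k-1)^2\,256^k}=-\frac{2}{\pi},\qquad \sum_{k=0}^{\infty}\frac{k(6k-1)}{(2k-1)^3}\frac{\binom{2k}{k}^3}{256^k}=\frac{1}{2\pi},$$ both of which hold, in the following sense: as $q\to1^-$ through real values, for every $k\ge 0$ the $k$-th summand of the first (respectively second) $q$-series tends to $-1$ (respectively $4$) times the $k$-th summand of the first (respectively second) of Sun's series, and the common right-hand side tends to $\frac{2}{\pi}$. -/

import Mathlib

open Filter Topology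

noncomputable section

/-- The `q`-number `[n]_q = (1 - q^n) / (1 - q)` for an integer `n` (possibly negative). -/
def qNum (q : ℂ) (n : ℤ) : ℂ := (1 - q ^ n) / (1 - q)

/-- The finite `q`-shifted factorial `(a; q)_n = ∏_{i < n} (1 - a q^i)`. -/
def qPoch (a q : ℂ) (n : ℕ) : ℂ := ∏ i ∈ Finset.range n, (1 - a * q ^ i)

/-- The infinite `q`-shifted factorial `(a; q)_∞ = ∏_{i ≥ 0} (1 - a q^i)`; the product converges
for `|q| < 1`, see `hasProd_qPochInf`. -/
def qPochInf (a q : ℂ) : ℂ := ∏' i : ℕ, (1 - a * q ^ i)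

theorem hasProd_qPochInf (a : ℂ) {q : ℂ} (hq : ‖q‖ < 1) :
    HasProd (fun i : ℕ => 1 - a * q ^ i) (qPochInf a q) := by
  have h : Multipliable fun i : ℕ => 1 + -(a * q ^ i) := by
    apply multipliable_one_add_of_summable
    simp only [norm_neg, norm_mul, norm_pow]
    exact (summable_geometric_of_lt_one (norm_nonneg q) hq).mul_left _
  simpa only [qPochInf, ← sub_eq_add_neg] using h.hasProd

/-- The common factor `(q; q²)_k² (q²; q⁴)_k / (q⁴; q⁴)_k³` of both summands. -/
def qFactor (q : ℂ) (k : ℕ) : ℂ :=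
  qPoch q (q ^ 2) k ^ 2 * qPoch (q ^ 2) (q ^ 4) k / qPoch (q ^ 4) (q ^ 4) k ^ 3

/-- The numerator `P₁`. -/
def numP₁ (q : ℂ) (k : ℕ) : ℂ :=
  -q ^ 2 + q ^ (4 * k + 2) + q ^ (6 * k + 3) + q ^ (8 * k) - q ^ (8 * k + 2) - q ^ (10 * k + 1)

/-- The numerator `P₂`. -/
def numP₂ (q : ℂ) (k : ℕ) : ℂ :=
  q ^ 3 - q ^ (4 * k + 3) - q ^ (6 * k + 4) - 2 * q ^ (8 * k + 1) + 2 * q ^ (8 * k + 3)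
    + q ^ (10 * k)

/-- The `k`-th summand of the first `q`-series. -/
def qTerm₁ (q : ℂ) (k : ℕ) : ℂ :=
  numP₁ q k * q ^ ((k : ℤ) ^ 2 - 4)
    / ((1 - q) ^ 2 * qNum q (2 * (k : ℤ) - 1) * qNum q (4 * (k : ℤ) - 2)) * qFactor q k

/-- The `k`-th summand of the second `q`-series. -/
def qTerm₂ (q : ℂ) (k : ℕ) : ℂ :=
  numP₂ q k * q ^ ((k : ℤ) ^ 2 - 7) * (1 + q)
    / ((1 - q) ^ 2 * qNum q (2 * (k : ℤ) - 1) ^ 2 * qNum q (4 * (k : ℤ) - 2)) * qFactor q k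

/-- The common sum `(q²; q⁴)_∞ (q⁶; q⁴)_∞ / (q⁴; q⁴)_∞²`. -/
def qSum (q : ℂ) : ℂ :=
  qPochInf (q ^ 2) (q ^ 4) * qPochInf (q ^ 6) (q ^ 4) / qPochInf (q ^ 4) (q ^ 4) ^ 2

/-- The `k`-th summand of Sun's series with sum `-2/π`. -/
def sunTerm₁ (k : ℕ) : ℝ :=
  (12 * (k : ℝ) ^ 2 - 1) * ((2 * k).choose k : ℝ) ^ 3 / ((2 * (k : ℝ) - 1) ^ 2 * 256 ^ k)

/-- The `k`-th summand of Sun's series with sum `1/(2π)`. -/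
def sunTerm₂ (k : ℕ) : ℝ :=
  (k : ℝ) * (6 * (k : ℝ) - 1) / (2 * (k : ℝ) - 1) ^ 3 * (((2 * k).choose k : ℝ) ^ 3 / 256 ^ k)

end

/-!
Both `q`-series are reduced to a `q`-analogue of Ramanujan's series
`∑ (6k+1) binom(2k,k)³ / 256^k = 4/π`, namely (`hasSum_qRamanujan`)
`∑ (1 - q^(6k+1)) q^(k²) (q; q²)_k² (q²; q⁴)_k / (q⁴; q⁴)_k³ = (q²; q⁴)_∞² / (q⁴; q⁴)_∞²`.
To prove the latter, the sum `T(q)` is embedded in a family `T(a)`, a limiting case of the quadratic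
summation of Gasper and Rahman. A telescoping sum (`paramTerm_sub_shift`) gives
`(1 - a q³)² T(a) = (1 - a q)² T(a q⁴)`. Iterating from `a = q` makes the shifted factorials appear,
and dominated convergence evaluates the remaining factor, since all terms of `T(a)` but the first
vanish as `a → 0`.

The summands `qTerm₁` and `qTerm₂` differ from those of the `q`-Ramanujan series, divided by
`1 - q²`, by explicit telescoping differences (`qTerm₁_eq_add_sub`, `qTerm₂_eq_add_sub`), whose sum
is zero.

As `q → 1⁻`, the numerators `P₁` and `P₂` vanish to second order, so that the limits of the summands
are read off from second-order Taylor coefficients. The product `qSum q` converges by dominated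
convergence to the Wallis product `∏ (1 - 1/(4i²)) = 2/π`; the domination is the inequality of
arithmetic and geometric means. A second use of dominated convergence gives Ramanujan's series
(`hasSum_ramanujan`), and Sun's two series follow from it by the limits of the same telescoping
differences.
-/

/-! ### Shifted factorials -/

theorem qPoch_succ (a q : ℂ) (n : ℕ) : qPoch a q (n + 1) = qPoch a q n * (1 - a * q ^ n) :=
  Finset.prod_range_succ _ _

theorem qPoch_succ' (a q : ℂ) (n : ℕ) : qPoch a q (n + 1) = (1 - a) * qPoch (a * q) q n := by
  simp only [qPoch, Finset.prod_range_succ', pow_zero, mul_one, pow_succ']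
  rw [mul_comm]
  congr 1
  exact Finset.prod_congr rfl fun i _ => by ring

theorem tendsto_qPoch (a : ℂ) {q : ℂ} (hq : ‖q‖ < 1) :
    Tendsto (qPoch a q) atTop (𝓝 (qPochInf a q)) :=
  (hasProd_qPochInf a hq).tendsto_prod_nat

theorem qPochInf_eq_mul (a : ℂ) {q : ℂ} (hq : ‖q‖ < 1) :
    qPochInf a q = (1 - a) * qPochInf (a * q) q := by
  refine tendsto_nhds_unique ((tendsto_add_atTop_iff_nat 1).2 (tendsto_qPoch a hq)) ?_
  simp only [qPoch_succ']
  exact (tendsto_qPoch _ hq).const_mul _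

theorem one_sub_ne_zero_of_norm_lt {z : ℂ} (hz : ‖z‖ < 1) : 1 - z ≠ 0 := by
  intro h
  rw [← sub_eq_zero.1 h, norm_one] at hz
  exact lt_irrefl _ hz

theorem one_sub_pow_ne_zero {q : ℂ} (hq : ‖q‖ < 1) {n : ℕ} (hn : n ≠ 0) : 1 - q ^ n ≠ 0 :=
  one_sub_ne_zero_of_norm_lt (by rw [norm_pow]; exact pow_lt_one₀ (norm_nonneg _) hq hn)

theorem norm_mul_pow_le {r : ℝ} {a p : ℂ} (ha : ‖a‖ ≤ r) (hp : ‖p‖ ≤ r) (i : ℕ) :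
    ‖a * p ^ i‖ ≤ r ^ (i + 1) := by
  rw [norm_mul, norm_pow, pow_succ']
  have := (norm_nonneg a).trans ha
  gcongr

theorem qPoch_ne_zero {r : ℝ} (hr : r < 1) {a p : ℂ} (ha : ‖a‖ ≤ r) (hp : ‖p‖ ≤ r) (n : ℕ) :
    qPoch a p n ≠ 0 :=
  Finset.prod_ne_zero_iff.2 fun i _ => one_sub_ne_zero_of_norm_lt <|
    (norm_mul_pow_le ha hp i).trans_lt
      (pow_lt_one₀ ((norm_nonneg a).trans ha) hr i.succ_ne_zero)

theorem qPochInf_ne_zero {a p : ℂ} (ha : ‖a‖ < 1) (hp : ‖p‖ < 1) : qPochInf a p ≠ 0 := by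
  have h := tprod_one_add_ne_zero_of_summable (R := ℂ) (f := fun i : ℕ => -(a * p ^ i)) ?_ ?_
  · simpa only [qPochInf, sub_eq_add_neg] using h
  · intro i
    rw [← sub_eq_add_neg]
    apply one_sub_ne_zero_of_norm_lt
    rw [norm_mul, norm_pow]
    exact (mul_le_of_le_one_right (norm_nonneg _) (pow_le_one₀ (norm_nonneg _) hp.le)).trans_lt ha
  · simp only [norm_neg, norm_mul, norm_pow]
    exact (summable_geometric_of_lt_one (norm_nonneg p) hp).mul_left _

theorem summable_pow_succ {r : ℝ} (h0 : 0 ≤ r) (h1 : r < 1) :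
    Summable fun i : ℕ => r ^ (i + 1) :=
  (summable_nat_add_iff 1).2 (summable_geometric_of_lt_one h0 h1)

/-- Finite shifted factorials are bounded, uniformly in `‖a‖, ‖p‖ ≤ r < 1`. -/
theorem exists_norm_qPoch_le {r : ℝ} (h0 : 0 ≤ r) (h1 : r < 1) :
    ∃ C : ℝ, 0 < C ∧ ∀ a p : ℂ, ‖a‖ ≤ r → ‖p‖ ≤ r → ∀ n, ‖qPoch a p n‖ ≤ C := by
  have hm : Multipliable fun i : ℕ => 1 + r ^ (i + 1) :=
    multipliable_one_add_of_summable (summable_pow_succ h0 h1).norm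
  obtain ⟨C, hC⟩ := hm.tendsto_prod_tprod_nat.bddAbove_range
  refine ⟨C, zero_lt_one.trans_le (by simpa using hC ⟨0, rfl⟩), fun a p ha hp n => ?_⟩
  refine le_trans ?_ (hC ⟨n, rfl⟩)
  rw [qPoch, norm_prod]
  refine Finset.prod_le_prod (fun _ _ => norm_nonneg _) fun i _ => ?_
  refine (norm_sub_le _ _).trans ?_
  rw [norm_one]
  gcongr
  exact norm_mul_pow_le ha hp i

/-- Finite shifted factorials are bounded away from `0`, uniformly in `‖a‖, ‖p‖ ≤ r < 1`. -/
theorem exists_le_norm_qPoch {r : ℝ} (h0 : 0 ≤ r) (h1 : r < 1) :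
    ∃ c : ℝ, 0 < c ∧ ∀ a p : ℂ, ‖a‖ ≤ r → ‖p‖ ≤ r → ∀ n, c ≤ ‖qPoch a p n‖ := by
  have hs : Summable fun i : ℕ => ‖-(r ^ (i + 1))‖ := (summable_pow_succ h0 h1).neg.norm
  have hlt : ∀ i : ℕ, r ^ (i + 1) < 1 := fun i => pow_lt_one₀ h0 h1 i.succ_ne_zero
  have hpos : ∀ i : ℕ, 0 < 1 + -(r ^ (i + 1)) := fun i => by linarith [hlt i]
  have hne := tprod_one_add_ne_zero_of_summable (fun i => (hpos i).ne') hs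
  have ht := (multipliable_one_add_of_summable hs).tendsto_prod_tprod_nat
  have hanti : Antitone fun n => ∏ i ∈ Finset.range n, (1 + -(r ^ (i + 1))) := by
    refine antitone_nat_of_succ_le fun n => ?_
    rw [Finset.prod_range_succ]
    exact mul_le_of_le_one_right (Finset.prod_nonneg fun i _ => (hpos i).le)
      (by linarith [pow_nonneg h0 (n + 1)])
  refine ⟨_, lt_of_le_of_ne (ge_of_tendsto' ht fun n =>
    Finset.prod_nonneg fun i _ => (hpos i).le) hne.symm, fun a p ha hp n => ?_⟩
  refine (hanti.le_of_tendsto ht n).trans ?_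
  rw [qPoch, norm_prod]
  refine Finset.prod_le_prod (fun i _ => (hpos i).le) fun i _ => ?_
  have := norm_sub_norm_le 1 (a * p ^ i)
  rw [norm_one] at this
  linarith [norm_mul_pow_le ha hp i]

@[fun_prop]
theorem ContinuousAt.qPoch {X : Type*} [TopologicalSpace X] {f g : X → ℂ} {x : X}
    (hf : ContinuousAt f x) (hg : ContinuousAt g x) (n : ℕ) :
    ContinuousAt (fun y => qPoch (f y) (g y) n) x := by
  unfold _root_.qPoch
  fun_prop

/-! ### A one-parameter summation -/

theorem hasSum_succ_sub {G : Type*} [NormedAddCommGroup G] {f : ℕ → G} (hf : Summable f) :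
    HasSum (fun k => f (k + 1) - f k) (-f 0) := by
  have h := ((hasSum_nat_add_iff' 1).2 hf.hasSum).sub hf.hasSum
  rwa [Finset.sum_range_one, sub_sub_cancel_left] at h

/-- The `q`-hypergeometric term
`(q; q²)_k² (q²; q⁴)_k / ((q⁴; q⁴)_k (a q³; q⁴)_k²) · a^k q^(k² - k)`. -/
noncomputable def hyperTerm (q a : ℂ) (k : ℕ) : ℂ :=
  qPoch q (q ^ 2) k ^ 2 * qPoch (q ^ 2) (q ^ 4) k
    / (qPoch (q ^ 4) (q ^ 4) k * qPoch (a * q ^ 3) (q ^ 4) k ^ 2) * (a / q) ^ k * q ^ k ^ 2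

/-- The summand `(1 - a q^(6k)) · hyperTerm q a k`, whose sum is
`(a q; q⁴)_∞² / (a q³; q⁴)_∞²`. -/
noncomputable def paramTerm (q a : ℂ) (k : ℕ) : ℂ := (1 - a * q ^ (6 * k)) * hyperTerm q a k

theorem norm_mul_cube_le {q a : ℂ} (hq : ‖q‖ < 1) (ha : ‖a‖ ≤ ‖q‖) : ‖a * q ^ 3‖ ≤ ‖q‖ := by
  rw [norm_mul, norm_pow]
  exact (mul_le_of_le_one_right (norm_nonneg _) (pow_le_one₀ (norm_nonneg _) hq.le)).trans ha

theorem norm_pow_le_self {q : ℂ} (hq : ‖q‖ < 1) {n : ℕ} (hn : n ≠ 0) : ‖q ^ n‖ ≤ ‖q‖ := by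
  rw [norm_pow]
  exact pow_le_of_le_one (norm_nonneg _) hq.le hn

/-- The bound is uniform in `a`, so that it also dominates the limit `a → 0`. -/
theorem exists_norm_hyperTerm_le {q : ℂ} (h0 : q ≠ 0) (hq : ‖q‖ < 1) :
    ∃ C : ℝ, ∀ a : ℂ, ‖a‖ ≤ ‖q‖ → ∀ k, ‖hyperTerm q a k‖ ≤ C * ‖q‖ ^ k := by
  obtain ⟨C, hC0, hC⟩ := exists_norm_qPoch_le (norm_nonneg q) hq
  obtain ⟨c, hc0, hc⟩ := exists_le_norm_qPoch (norm_nonneg q) hq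
  refine ⟨C ^ 2 * C / (c * c ^ 2), fun a ha k => ?_⟩
  have h2 := norm_pow_le_self hq two_ne_zero
  have h4 := norm_pow_le_self hq four_ne_zero
  have e1 := hC q (q ^ 2) le_rfl h2 k
  have e2 := hC (q ^ 2) (q ^ 4) h2 h4 k
  have e3 := hc (q ^ 4) (q ^ 4) h4 h4 k
  have e4 := hc (a * q ^ 3) (q ^ 4) (norm_mul_cube_le hq ha) h4 k
  have e5 : ‖a / q‖ ^ k ≤ 1 := by
    refine pow_le_one₀ (norm_nonneg _) ?_
    rw [norm_div]
    exact div_le_one_of_le₀ ha (norm_nonneg _)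
  have e6 : ‖q‖ ^ k ^ 2 ≤ ‖q‖ ^ k :=
    pow_le_pow_of_le_one (norm_nonneg _) hq.le (Nat.le_self_pow two_ne_zero k)
  simp only [hyperTerm, norm_mul, norm_div, norm_pow] at *
  calc _ ≤ C ^ 2 * C / (c * c ^ 2) * 1 * ‖q‖ ^ k := by gcongr
    _ = _ := by ring

theorem exists_norm_paramTerm_le {q : ℂ} (h0 : q ≠ 0) (hq : ‖q‖ < 1) :
    ∃ C : ℝ, ∀ a : ℂ, ‖a‖ ≤ ‖q‖ → ∀ k, ‖paramTerm q a k‖ ≤ C * ‖q‖ ^ k := by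
  obtain ⟨C, hC⟩ := exists_norm_hyperTerm_le h0 hq
  refine ⟨2 * C, fun a ha k => ?_⟩
  have h1 : ‖1 - a * q ^ (6 * k)‖ ≤ 2 := by
    refine (norm_sub_le _ _).trans ?_
    rw [norm_one, norm_mul, norm_pow]
    linarith [mul_le_one₀ (ha.trans hq.le) (pow_nonneg (norm_nonneg q) (6 * k))
      (pow_le_one₀ (norm_nonneg q) hq.le)]
  rw [paramTerm, norm_mul, mul_assoc]
  exact mul_le_mul h1 (hC a ha k) (norm_nonneg _) zero_le_two

theorem summable_geometric_norm {q : ℂ} (hq : ‖q‖ < 1) (C : ℝ) :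
    Summable fun k : ℕ => C * ‖q‖ ^ k :=
  (summable_geometric_of_lt_one (norm_nonneg q) hq).mul_left C

theorem summable_norm_hyperTerm {q a : ℂ} (h0 : q ≠ 0) (hq : ‖q‖ < 1) (ha : ‖a‖ ≤ ‖q‖) :
    Summable fun k => ‖hyperTerm q a k‖ := by
  obtain ⟨C, hC⟩ := exists_norm_hyperTerm_le h0 hq
  exact (summable_geometric_norm hq C).of_nonneg_of_le (fun _ => norm_nonneg _) (hC a ha)

theorem summable_paramTerm {q a : ℂ} (h0 : q ≠ 0) (hq : ‖q‖ < 1) (ha : ‖a‖ ≤ ‖q‖) :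
    Summable (paramTerm q a) := by
  obtain ⟨C, hC⟩ := exists_norm_paramTerm_le h0 hq
  exact Summable.of_norm_bounded (summable_geometric_norm hq C) (hC a ha)

theorem tendsto_pow_mul_cofinite {q : ℂ} (hq : ‖q‖ < 1) {n : ℕ} (hn : n ≠ 0) :
    Tendsto (fun k : ℕ => q ^ (n * k)) cofinite (𝓝 0) := by
  rw [Nat.cofinite_eq_atTop]
  simp only [pow_mul]
  exact tendsto_pow_atTop_nhds_zero_of_norm_lt_one
    (by rw [norm_pow]; exact pow_lt_one₀ (norm_nonneg _) hq hn)

/-- Contiguity in `a`: the two sides differ by the telescoping sum of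
`-(1 - a q³)² (1 + a q^(2k)) (1 - q^(4k)) · hyperTerm q a k`. -/
theorem paramTerm_sub_shift {q a : ℂ} (h0 : q ≠ 0) (hq : ‖q‖ < 1) (ha : ‖a‖ ≤ ‖q‖) (k : ℕ) :
    (1 - a * q ^ 3) ^ 2 * paramTerm q a k - (1 - a * q) ^ 2 * paramTerm q (a * q ^ 4) k
      = (1 - a * q ^ 3) ^ 2 *
        (-(1 + a * q ^ (2 * (k + 1))) * (1 - q ^ (4 * (k + 1))) * hyperTerm q a (k + 1)
          - -(1 + a * q ^ (2 * k)) * (1 - q ^ (4 * k)) * hyperTerm q a k) := by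
  have h4 := norm_pow_le_self hq four_ne_zero
  have ha3 := norm_mul_cube_le hq ha
  have n1 : 1 - a * q ^ 3 ≠ 0 := one_sub_ne_zero_of_norm_lt (ha3.trans_lt hq)
  have n2 : qPoch (a * q ^ 3) (q ^ 4) k ≠ 0 := qPoch_ne_zero hq ha3 h4 k
  have n3 : qPoch (q ^ 4) (q ^ 4) k ≠ 0 := qPoch_ne_zero hq h4 h4 k
  have n4 : 1 - q ^ 4 * (q ^ 4) ^ k ≠ 0 := by
    have := one_sub_pow_ne_zero hq (n := 4 * (k + 1)) (by omega)
    rwa [← pow_mul, ← pow_add, show 4 + 4 * k = 4 * (k + 1) by ring]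
  have n5 : 1 - a * q ^ 3 * (q ^ 4) ^ k ≠ 0 := by
    have := qPoch_ne_zero hq ha3 h4 (k + 1)
    rw [qPoch_succ] at this
    exact right_ne_zero_of_mul this
  -- the shift of `a` moves the shifted factorial by one factor
  have hs : qPoch (a * q ^ 4 * q ^ 3) (q ^ 4) k
      = qPoch (a * q ^ 3) (q ^ 4) k * (1 - a * q ^ 3 * (q ^ 4) ^ k) / (1 - a * q ^ 3) := by
    rw [eq_div_iff n1, ← qPoch_succ, qPoch_succ']
    ring_nf
  have hw : hyperTerm q (a * q ^ 4) k = hyperTerm q a k * (q ^ (2 * k)) ^ 2 *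
      ((1 - a * q ^ 3) / (1 - a * q ^ 3 * (q ^ 4) ^ k)) ^ 2 := by
    rw [hyperTerm, hyperTerm, hs, show a * q ^ 4 / q = a / q * q ^ 4 by ring, mul_pow (a / q)]
    field_simp
    ring
  have hw' : hyperTerm q a (k + 1) = hyperTerm q a k *
      ((1 - q * q ^ (2 * k)) ^ 2 * (1 - q ^ 2 * (q ^ 4) ^ k) * (a * q ^ (2 * k)) /
        ((1 - q ^ 4 * (q ^ 4) ^ k) * (1 - a * q ^ 3 * (q ^ 4) ^ k) ^ 2)) := by
    rw [hyperTerm, hyperTerm, qPoch_succ, qPoch_succ, qPoch_succ, qPoch_succ, ← pow_mul q 2 k,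
      pow_succ (a / q), show (k + 1) ^ 2 = k ^ 2 + 2 * k + 1 by ring, pow_succ q (k ^ 2 + 2 * k),
      pow_add q (k ^ 2)]
    field_simp
  rw [paramTerm, paramTerm, hw, hw']
  rw [show q ^ (6 * k) = (q ^ (2 * k)) ^ 3 by ring, show q ^ (4 * k) = (q ^ (2 * k)) ^ 2 by ring,
    show q ^ (4 * (k + 1)) = q ^ 4 * (q ^ (2 * k)) ^ 2 by ring,
    show q ^ (2 * (k + 1)) = q ^ 2 * q ^ (2 * k) by ring] at *
  rw [show (q ^ 4) ^ k = (q ^ (2 * k)) ^ 2 by ring] at *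
  generalize q ^ (2 * k) = y at *
  generalize hyperTerm q a k = w at *
  field_simp
  ring

theorem tsum_paramTerm_shift {q a : ℂ} (h0 : q ≠ 0) (hq : ‖q‖ < 1) (ha : ‖a‖ ≤ ‖q‖) :
    (1 - a * q ^ 3) ^ 2 * ∑' k, paramTerm q a k
      = (1 - a * q) ^ 2 * ∑' k, paramTerm q (a * q ^ 4) k := by
  have ha4 : ‖a * q ^ 4‖ ≤ ‖q‖ := by
    rw [norm_mul, norm_pow]
    exact (mul_le_of_le_one_right (norm_nonneg _) (pow_le_one₀ (norm_nonneg _) hq.le)).trans ha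
  have hV : Summable fun k =>
      -(1 + a * q ^ (2 * k)) * (1 - q ^ (4 * k)) * hyperTerm q a k := by
    have h := (summable_norm_hyperTerm h0 hq ha).mul_tendsto_const
      (((tendsto_pow_mul_cofinite hq two_ne_zero).const_mul a).const_add 1 |>.neg.mul
        ((tendsto_pow_mul_cofinite hq four_ne_zero).const_sub 1))
    simpa only [mul_comm (hyperTerm q a _)] using h
  have h1 := (hasSum_succ_sub hV).mul_left ((1 - a * q ^ 3) ^ 2)
  have h2 := ((summable_paramTerm h0 hq ha).hasSum.mul_left ((1 - a * q ^ 3) ^ 2)).sub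
    ((summable_paramTerm h0 hq ha4).hasSum.mul_left ((1 - a * q) ^ 2))
  simp only [paramTerm_sub_shift h0 hq ha] at h2
  have h3 := h2.unique h1
  simp only [mul_zero, pow_zero, sub_self, zero_mul, neg_zero] at h3
  exact sub_eq_zero.1 h3

theorem tsum_paramTerm_iterate {q : ℂ} (h0 : q ≠ 0) (hq : ‖q‖ < 1) (n : ℕ) :
    qPoch (q ^ 4) (q ^ 4) n ^ 2 * ∑' k, paramTerm q q k
      = qPoch (q ^ 2) (q ^ 4) n ^ 2 * ∑' k, paramTerm q (q * (q ^ 4) ^ n) k := by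
  induction n with
  | zero => simp [qPoch]
  | succ n ih =>
    have ha : ‖q * (q ^ 4) ^ n‖ ≤ ‖q‖ := by
      rw [← pow_mul, ← pow_succ']
      exact norm_pow_le_self hq (by omega)
    have h := tsum_paramTerm_shift h0 hq ha
    rw [qPoch_succ, qPoch_succ]
    rw [show q * (q ^ 4) ^ n * q ^ 3 = q ^ 4 * (q ^ 4) ^ n by ring,
      show q * (q ^ 4) ^ n * q = q ^ 2 * (q ^ 4) ^ n by ring,
      show q * (q ^ 4) ^ n * q ^ 4 = q * (q ^ 4) ^ (n + 1) by ring] at h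
    linear_combination (1 - q ^ 4 * (q ^ 4) ^ n) ^ 2 * ih + qPoch (q ^ 2) (q ^ 4) n ^ 2 * h

theorem tendsto_tsum_paramTerm {q : ℂ} (h0 : q ≠ 0) (hq : ‖q‖ < 1) :
    Tendsto (fun n : ℕ => ∑' k, paramTerm q (q * (q ^ 4) ^ n) k) atTop (𝓝 1) := by
  obtain ⟨C, hC⟩ := exists_norm_paramTerm_le h0 hq
  have hq4 : ‖q ^ 4‖ < 1 := (norm_pow_le_self hq four_ne_zero).trans_lt hq
  have ha : Tendsto (fun n : ℕ => q * (q ^ 4) ^ n) atTop (𝓝 0) := by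
    simpa using (tendsto_pow_atTop_nhds_zero_of_norm_lt_one hq4).const_mul q
  have hlim : ∀ k, Tendsto (fun n : ℕ => paramTerm q (q * (q ^ 4) ^ n) k) atTop
      (𝓝 (paramTerm q 0 k)) := by
    intro k
    refine Tendsto.comp (g := fun a => paramTerm q a k) ?_ ha
    refine ContinuousAt.tendsto ?_
    unfold paramTerm hyperTerm
    have hne : qPoch (q ^ 4) (q ^ 4) k * qPoch (0 * q ^ 3) (q ^ 4) k ^ 2 ≠ 0 := by
      have h4 := norm_pow_le_self hq four_ne_zero
      exact mul_ne_zero (qPoch_ne_zero hq h4 h4 k)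
        (pow_ne_zero _ (qPoch_ne_zero hq (by simp) h4 k))
    fun_prop (disch := exact hne)
  have h := tendsto_tsum_of_dominated_convergence (summable_geometric_norm hq C) hlim
    (Eventually.of_forall fun n k => hC _ (by
      rw [← pow_mul, ← pow_succ']
      exact norm_pow_le_self hq (by omega)) k)
  convert h using 2
  rw [tsum_eq_single 0]
  · simp [paramTerm, hyperTerm, qPoch]
  · intro k hk
    simp [paramTerm, hyperTerm, hk]

/-- The `q`-analogue `∑ (1 - q^(6k+1)) q^(k²) (q; q²)_k² (q²; q⁴)_k / (q⁴; q⁴)_k³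
= (q²; q⁴)_∞² / (q⁴; q⁴)_∞²` of Ramanujan's series `∑ (6k+1) binom(2k,k)³ / 256^k = 4/π`,
with both sides divided by `1 - q²`. -/
theorem hasSum_qRamanujan {q : ℂ} (h0 : q ≠ 0) (hq : ‖q‖ < 1) :
    HasSum (fun k : ℕ => (1 - q ^ (6 * k + 1)) / (1 - q ^ 2) * (q ^ k ^ 2 * qFactor q k))
      (qSum q) := by
  have hq4 : ‖q ^ 4‖ < 1 := (norm_pow_le_self hq four_ne_zero).trans_lt hq
  have hlim := tendsto_nhds_unique
    (((tendsto_qPoch (q ^ 4) hq4).pow 2).mul_const (∑' k, paramTerm q q k))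
    ((((tendsto_qPoch (q ^ 2) hq4).pow 2).mul (tendsto_tsum_paramTerm h0 hq)).congr
      fun n => (tsum_paramTerm_iterate h0 hq n).symm)
  have hne := qPochInf_ne_zero hq4 hq4
  have hne2 := one_sub_pow_ne_zero hq two_ne_zero
  have hterm : ∀ k, (1 - q ^ (6 * k + 1)) / (1 - q ^ 2) * (q ^ k ^ 2 * qFactor q k)
      = paramTerm q q k / (1 - q ^ 2) := by
    intro k
    rw [paramTerm, hyperTerm, qFactor, div_self h0, one_pow, ← pow_succ' q 3,
      ← pow_succ' q (6 * k)]
    ring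
  have hsum : qSum q = (∑' k, paramTerm q q k) / (1 - q ^ 2) := by
    rw [qSum, eq_div_iff hne2, div_mul_eq_mul_div, div_eq_iff (pow_ne_zero _ hne),
      mul_comm _ (qPochInf _ _ ^ 2), hlim, qPochInf_eq_mul (q ^ 2) hq4, ← pow_add]
    ring
  rw [hsum, funext hterm]
  exact (summable_paramTerm h0 hq le_rfl).hasSum.div_const (1 - q ^ 2)

/-! ### The two `q`-series -/

/-- The term `q^(k²) (q; q²)_k² (q²; q⁴)_k / (q⁴; q⁴)_k³` common to all the `q`-series. -/
noncomputable def qWeight (q : ℂ) (k : ℕ) : ℂ := q ^ k ^ 2 * qFactor q k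

theorem summable_norm_qWeight {q : ℂ} (h0 : q ≠ 0) (hq : ‖q‖ < 1) :
    Summable fun k => ‖qWeight q k‖ := by
  have h : qWeight q = hyperTerm q q := by
    ext k
    rw [qWeight, hyperTerm, qFactor, div_self h0, one_pow, ← pow_succ' q 3]
    ring
  rw [h]
  exact summable_norm_hyperTerm h0 hq le_rfl

theorem qFactor_succ (q : ℂ) (k : ℕ) : qFactor q (k + 1) = qFactor q k *
    ((1 - q ^ (2 * k + 1)) ^ 2 * (1 - q ^ (4 * k + 2)) / (1 - q ^ (4 * k + 4)) ^ 3) := by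
  simp only [qFactor, qPoch_succ, ← pow_mul, ← pow_add, ← pow_succ']
  rw [add_comm 2 (4 * k), add_comm 4 (4 * k), div_mul_div_comm, mul_pow (qPoch _ _ k) _ 3]
  congr 1
  ring

theorem qWeight_succ (q : ℂ) (k : ℕ) : qWeight q (k + 1) = qWeight q k *
    (q ^ (2 * k + 1) *
      ((1 - q ^ (2 * k + 1)) ^ 2 * (1 - q ^ (4 * k + 2)) / (1 - q ^ (4 * k + 4)) ^ 3)) := by
  rw [qWeight, qWeight, qFactor_succ]
  ring

theorem sq_sub_pow_ne_zero {q : ℂ} (h0 : q ≠ 0) (hq : ‖q‖ < 1) (k : ℕ) :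
    q ^ 2 - (q ^ (2 * k)) ^ 2 ≠ 0 := by
  intro h
  have h1 := congrArg norm (sub_eq_zero.1 h)
  rw [← pow_mul, norm_pow, norm_pow] at h1
  have := pow_right_injective₀ (norm_pos_iff.2 h0) hq.ne h1
  omega

theorem sub_pow_ne_zero {q : ℂ} (h0 : q ≠ 0) (hq : ‖q‖ < 1) (k : ℕ) : q - q ^ (2 * k) ≠ 0 := by
  have h := sq_sub_pow_ne_zero h0 hq k
  rw [sq_sub_sq] at h
  exact right_ne_zero_of_mul h

theorem add_pow_ne_zero {q : ℂ} (h0 : q ≠ 0) (hq : ‖q‖ < 1) (k : ℕ) : q + q ^ (2 * k) ≠ 0 := by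
  have h := sq_sub_pow_ne_zero h0 hq k
  rw [sq_sub_sq] at h
  exact left_ne_zero_of_mul h

theorem zpow_sq_sub {q : ℂ} (h0 : q ≠ 0) (k m : ℕ) :
    q ^ ((k : ℤ) ^ 2 - m) = q ^ k ^ 2 / q ^ m := by
  rw [zpow_sub₀ h0, zpow_natCast, ← Nat.cast_pow, zpow_natCast]

theorem qNum_two_mul_sub_one {q : ℂ} (h0 : q ≠ 0) (k : ℕ) :
    qNum q (2 * (k : ℤ) - 1) = (q - q ^ (2 * k)) / q / (1 - q) := by
  have h : q ^ (2 * (k : ℤ)) = q ^ (2 * k) := by norm_cast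
  rw [qNum, zpow_sub₀ h0, zpow_one, h, sub_div q, div_self h0]

theorem qNum_four_mul_sub_two {q : ℂ} (h0 : q ≠ 0) (k : ℕ) :
    qNum q (4 * (k : ℤ) - 2) = (q - q ^ (2 * k)) * (q + q ^ (2 * k)) / q ^ 2 / (1 - q) := by
  rw [qNum, zpow_sub₀ h0]
  have h : q ^ (4 * (k : ℤ)) = (q ^ (2 * k)) ^ 2 := by
    rw [← pow_mul, show 2 * k * 2 = 4 * k by ring]
    norm_cast
  rw [h, show q ^ (2 : ℤ) = q ^ 2 from rfl]
  field_simp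
  ring

theorem qTerm₁_eq {q : ℂ} (h0 : q ≠ 0) (hq : ‖q‖ < 1) (k : ℕ) :
    qTerm₁ q k = numP₁ q k / (q * (q - q ^ (2 * k)) ^ 2 * (q + q ^ (2 * k))) * qWeight q k := by
  have h1 : 1 - q ≠ 0 := by simpa using one_sub_pow_ne_zero hq one_ne_zero
  have h2 := sub_pow_ne_zero h0 hq k
  have h3 := add_pow_ne_zero h0 hq k
  have h4 := zpow_sq_sub h0 k 4
  rw [Nat.cast_ofNat] at h4
  rw [qTerm₁, qWeight, qNum_two_mul_sub_one h0, qNum_four_mul_sub_two h0, h4]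
  field_simp

theorem qTerm₂_eq {q : ℂ} (h0 : q ≠ 0) (hq : ‖q‖ < 1) (k : ℕ) :
    qTerm₂ q k = numP₂ q k * (1 - q ^ 2) / (q ^ 3 * (q - q ^ (2 * k)) ^ 3 * (q + q ^ (2 * k)))
      * qWeight q k := by
  have h1 : 1 - q ≠ 0 := by simpa using one_sub_pow_ne_zero hq one_ne_zero
  have h2 := sub_pow_ne_zero h0 hq k
  have h3 := add_pow_ne_zero h0 hq k
  have h4 := zpow_sq_sub h0 k 7
  rw [Nat.cast_ofNat] at h4
  rw [qTerm₂, qWeight, qNum_two_mul_sub_one h0, qNum_four_mul_sub_two h0, h4]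
  field_simp
  ring

/-- The rational certificate of the first series: its summands differ from those of the
`q`-Ramanujan series by the differences of `qCert₁ q k * qWeight q k`. -/
noncomputable def qCert₁ (q : ℂ) (k : ℕ) : ℂ :=
  (1 - q ^ (4 * k)) ^ 3 * q / ((1 - q ^ 2) * (q - q ^ (2 * k)) ^ 2 * (q + q ^ (2 * k)))

/-- The rational certificate of the second series, in the same sense as `qCert₁`. -/
noncomputable def qCert₂ (q : ℂ) (k : ℕ) : ℂ :=
  (1 - q ^ (4 * k)) ^ 3 * (2 * q ^ 2 - 1 - q * q ^ (2 * k))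
    / ((1 - q ^ 2) * (q - q ^ (2 * k)) ^ 3 * (q + q ^ (2 * k)))

theorem qTerm₁_eq_add_sub {q : ℂ} (h0 : q ≠ 0) (hq : ‖q‖ < 1) (k : ℕ) :
    qTerm₁ q k = (1 - q ^ (6 * k + 1)) / (1 - q ^ 2) * qWeight q k
      + (qCert₁ q (k + 1) * qWeight q (k + 1) - qCert₁ q k * qWeight q k) := by
  have h2 := sub_pow_ne_zero h0 hq k
  have h3 := add_pow_ne_zero h0 hq k
  have h5 := sub_pow_ne_zero h0 hq (k + 1)
  have h6 := add_pow_ne_zero h0 hq (k + 1)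
  have h7 := one_sub_pow_ne_zero hq two_ne_zero
  have h8 := one_sub_pow_ne_zero hq (n := 4 * k + 4) (by omega)
  rw [qTerm₁_eq h0 hq, qWeight_succ, qCert₁, qCert₁, numP₁]
  rw [show q ^ (2 * (k + 1)) = q ^ 2 * q ^ (2 * k) by ring] at *
  rw [show q ^ (4 * k + 4) = q ^ 4 * (q ^ (2 * k)) ^ 2 by ring] at *
  rw [show q ^ (4 * (k + 1)) = q ^ 4 * (q ^ (2 * k)) ^ 2 by ring,
    show q ^ (4 * k + 2) = q ^ 2 * (q ^ (2 * k)) ^ 2 by ring,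
    show q ^ (2 * k + 1) = q * q ^ (2 * k) by ring,
    show q ^ (6 * k + 1) = q * (q ^ (2 * k)) ^ 3 by ring,
    show q ^ (6 * k + 3) = q ^ 3 * (q ^ (2 * k)) ^ 3 by ring,
    show q ^ (8 * k) = (q ^ (2 * k)) ^ 4 by ring,
    show q ^ (8 * k + 2) = q ^ 2 * (q ^ (2 * k)) ^ 4 by ring,
    show q ^ (10 * k + 1) = q * (q ^ (2 * k)) ^ 5 by ring,
    show q ^ (4 * k) = (q ^ (2 * k)) ^ 2 by ring]
  generalize q ^ (2 * k) = y at *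
  generalize qWeight q k = w at *
  rw [show q - q ^ 2 * y = q * (1 - q * y) by ring] at *
  rw [show q + q ^ 2 * y = q * (1 + q * y) by ring] at *
  have h5' := right_ne_zero_of_mul h5
  have h6' := right_ne_zero_of_mul h6
  field_simp
  ring

theorem qTerm₂_eq_add_sub {q : ℂ} (h0 : q ≠ 0) (hq : ‖q‖ < 1) (k : ℕ) :
    qTerm₂ q k = (1 - q ^ (6 * k + 1)) / (1 - q ^ 2) * qWeight q k
      + (qCert₂ q (k + 1) * qWeight q (k + 1) - qCert₂ q k * qWeight q k) := by
  have h2 := sub_pow_ne_zero h0 hq k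
  have h3 := add_pow_ne_zero h0 hq k
  have h5 := sub_pow_ne_zero h0 hq (k + 1)
  have h6 := add_pow_ne_zero h0 hq (k + 1)
  have h7 := one_sub_pow_ne_zero hq two_ne_zero
  have h8 := one_sub_pow_ne_zero hq (n := 4 * k + 4) (by omega)
  rw [qTerm₂_eq h0 hq, qWeight_succ, qCert₂, qCert₂, numP₂]
  rw [show q ^ (2 * (k + 1)) = q ^ 2 * q ^ (2 * k) by ring] at *
  rw [show q ^ (4 * k + 4) = q ^ 4 * (q ^ (2 * k)) ^ 2 by ring] at *
  rw [show q ^ (4 * (k + 1)) = q ^ 4 * (q ^ (2 * k)) ^ 2 by ring,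
    show q ^ (4 * k + 2) = q ^ 2 * (q ^ (2 * k)) ^ 2 by ring,
    show q ^ (4 * k + 3) = q ^ 3 * (q ^ (2 * k)) ^ 2 by ring,
    show q ^ (2 * k + 1) = q * q ^ (2 * k) by ring,
    show q ^ (6 * k + 1) = q * (q ^ (2 * k)) ^ 3 by ring,
    show q ^ (6 * k + 4) = q ^ 4 * (q ^ (2 * k)) ^ 3 by ring,
    show q ^ (8 * k + 1) = q * (q ^ (2 * k)) ^ 4 by ring,
    show q ^ (8 * k + 3) = q ^ 3 * (q ^ (2 * k)) ^ 4 by ring,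
    show q ^ (10 * k) = (q ^ (2 * k)) ^ 5 by ring,
    show q ^ (4 * k) = (q ^ (2 * k)) ^ 2 by ring]
  generalize q ^ (2 * k) = y at *
  generalize qWeight q k = w at *
  rw [show q - q ^ 2 * y = q * (1 - q * y) by ring] at *
  rw [show q + q ^ 2 * y = q * (1 + q * y) by ring] at *
  have h5' := right_ne_zero_of_mul h5
  have h6' := right_ne_zero_of_mul h6
  field_simp
  ring

theorem hasSum_of_eq_add_sub {q : ℂ} (h0 : q ≠ 0) (hq : ‖q‖ < 1) {f R : ℕ → ℂ}
    (hR : ∃ c, Tendsto R cofinite (𝓝 c)) (hR0 : R 0 = 0)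
    (hf : ∀ k, f k = (1 - q ^ (6 * k + 1)) / (1 - q ^ 2) * qWeight q k
      + (R (k + 1) * qWeight q (k + 1) - R k * qWeight q k)) :
    HasSum f (qSum q) := by
  obtain ⟨c, hc⟩ := hR
  have hs : Summable fun k => R k * qWeight q k := by
    simpa only [mul_comm] using (summable_norm_qWeight h0 hq).mul_tendsto_const hc
  have h := (hasSum_qRamanujan h0 hq).add (hasSum_succ_sub hs)
  rw [hR0, zero_mul, neg_zero, add_zero] at h
  rwa [funext hf]

theorem hasSum_qTerm₁ {q : ℂ} (h0 : q ≠ 0) (hq : ‖q‖ < 1) : HasSum (qTerm₁ q) (qSum q) := by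
  have h2 := tendsto_pow_mul_cofinite hq two_ne_zero
  have h4 := tendsto_pow_mul_cofinite hq four_ne_zero
  have h7 := one_sub_pow_ne_zero hq two_ne_zero
  refine hasSum_of_eq_add_sub h0 hq (R := qCert₁ q) ?_ (by simp [qCert₁])
    (qTerm₁_eq_add_sub h0 hq)
  exact ⟨_, (((h4.const_sub 1).pow 3).mul_const q).div
    ((((h2.const_sub q).pow 2).const_mul (1 - q ^ 2)).mul (h2.const_add q)) (by simp [h0, h7])⟩

theorem hasSum_qTerm₂ {q : ℂ} (h0 : q ≠ 0) (hq : ‖q‖ < 1) : HasSum (qTerm₂ q) (qSum q) := by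
  have h2 := tendsto_pow_mul_cofinite hq two_ne_zero
  have h4 := tendsto_pow_mul_cofinite hq four_ne_zero
  have h7 := one_sub_pow_ne_zero hq two_ne_zero
  refine hasSum_of_eq_add_sub h0 hq (R := qCert₂ q) ?_ (by simp [qCert₂])
    (qTerm₂_eq_add_sub h0 hq)
  exact ⟨_, (((h4.const_sub 1).pow 3).mul ((h2.const_mul q).const_sub (2 * q ^ 2 - 1))).div
    ((((h2.const_sub q).pow 3).const_mul (1 - q ^ 2)).mul (h2.const_add q)) (by simp [h0, h7])⟩

/-! ### Limits of the summands as `q → 1` -/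

theorem tendsto_ofReal_nhdsLT_one :
    Tendsto (fun q : ℝ => (q : ℂ)) (𝓝[<] 1) (𝓝[≠] 1) := by
  refine tendsto_nhdsWithin_iff.2 ⟨?_, ?_⟩
  · have h := (Complex.continuous_ofReal.tendsto 1).mono_left (nhdsWithin_le_nhds (s := Set.Iio 1))
    rwa [Complex.ofReal_one] at h
  · filter_upwards [self_mem_nhdsWithin] with q hq
    have hq' : q ≠ 1 := ne_of_lt hq
    simpa using hq'

theorem tendsto_qNum (n : ℤ) : Tendsto (fun q : ℂ => qNum q n) (𝓝[≠] 1) (𝓝 (n : ℂ)) := by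
  have h := (hasDerivAt_zpow n (1 : ℂ) (Or.inl one_ne_zero)).tendsto_slope
  rw [one_zpow, mul_one] at h
  refine h.congr fun q => ?_
  rw [slope_def_field, one_zpow, qNum, ← neg_sub (1 : ℂ), ← neg_sub (1 : ℂ) q, neg_div_neg_eq]

theorem tendsto_one_sub_pow_div (n : ℕ) :
    Tendsto (fun q : ℂ => (1 - q ^ n) / (1 - q)) (𝓝[≠] 1) (𝓝 (n : ℂ)) := by
  have h := tendsto_qNum n
  simpa only [qNum, zpow_natCast, Int.cast_natCast] using h

/-- The second-order Taylor coefficient of `q ^ m` at `q = 1`. -/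
theorem tendsto_pow_taylor_two (m : ℕ) :
    Tendsto (fun q : ℂ => (q ^ m - 1 - m * (q - 1)) / (1 - q) ^ 2) (𝓝[≠] 1)
      (𝓝 ((m : ℂ) * (m - 1) / 2)) := by
  obtain ⟨g, hg, hg1, hgm⟩ : ∃ g : ℂ → ℂ, Continuous g ∧ g 1 = m * (m - 1) / 2 ∧
      ∀ q, q ^ m - 1 - m * (q - 1) = (1 - q) ^ 2 * g q := by
    induction m with
    | zero => exact ⟨0, continuous_zero, by simp, by simp⟩
    | succ m ih =>
      obtain ⟨g, hg, hg1, hgm⟩ := ih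
      refine ⟨fun q => q * g q + m, by fun_prop, ?_, fun q => ?_⟩
      · dsimp only
        rw [hg1]
        push_cast
        ring
      · push_cast
        linear_combination q * hgm q
  rw [← hg1]
  refine ((hg.tendsto 1).mono_left nhdsWithin_le_nhds).congr' ?_
  filter_upwards [self_mem_nhdsWithin] with q hq
  rw [hgm, mul_div_cancel_left₀]
  exact pow_ne_zero _ (sub_ne_zero.2 (Ne.symm hq))

theorem tendsto_numP₁_div (k : ℕ) :
    Tendsto (fun q : ℂ => numP₁ q k / (1 - q) ^ 2) (𝓝[≠] 1) (𝓝 (2 - 24 * (k : ℂ) ^ 2)) := by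
  have E := tendsto_pow_taylor_two
  have h := (((((E 2).neg.add (E (4 * k + 2))).add (E (6 * k + 3))).add (E (8 * k))).sub
    (E (8 * k + 2))).sub (E (10 * k + 1))
  convert h using 1
  · ext q
    simp only [← neg_div, ← add_div, ← sub_div, numP₁]
    push_cast
    ring
  · congr 1
    push_cast
    ring

theorem tendsto_numP₂_div (k : ℕ) :
    Tendsto (fun q : ℂ => numP₂ q k / (1 - q) ^ 2) (𝓝[≠] 1)
      (𝓝 (4 * (k : ℂ) * (6 * k - 1))) := by
  have E := tendsto_pow_taylor_two
  have h := (((((E 3).sub (E (4 * k + 3))).sub (E (6 * k + 4))).sub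
    ((E (8 * k + 1)).const_mul 2)).add ((E (8 * k + 3)).const_mul 2)).add (E (10 * k))
  convert h using 1
  · ext q
    simp only [← mul_div_assoc, ← add_div, ← sub_div, numP₂]
    push_cast
    ring
  · congr 1
    push_cast
    ring

/-- The common factor `binom(2k,k)³ / 256^k` of Ramanujan's and Sun's series. -/
noncomputable def binomWeight (k : ℕ) : ℝ := ((2 * k).choose k : ℝ) ^ 3 / 256 ^ k

theorem binomWeight_succ (k : ℕ) : binomWeight (k + 1) = binomWeight k *
    ((2 * (k : ℝ) + 1) ^ 3 / (32 * ((k : ℝ) + 1) ^ 3)) := by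
  have h : (k + 1 : ℝ) * ((2 * (k + 1)).choose (k + 1) : ℝ)
      = 2 * (2 * k + 1) * ((2 * k).choose k : ℝ) := by
    have := Nat.succ_mul_centralBinom_succ k
    rw [Nat.centralBinom_eq_two_mul_choose, Nat.centralBinom_eq_two_mul_choose] at this
    exact_mod_cast this
  have hk : (k + 1 : ℝ) ≠ 0 := by positivity
  rw [mul_comm, ← eq_div_iff hk] at h
  rw [binomWeight, binomWeight, h]
  field_simp
  ring

theorem tendsto_qFactor (k : ℕ) :
    Tendsto (fun q : ℂ => qFactor q k) (𝓝[≠] 1) (𝓝 (binomWeight k : ℂ)) := by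
  induction k with
  | zero => simp [qFactor, qPoch, binomWeight]
  | succ k ih =>
    have E := tendsto_one_sub_pow_div
    have hne : (((4 * k + 4 : ℕ) : ℂ)) ^ 3 ≠ 0 := pow_ne_zero _ (Nat.cast_ne_zero.2 (by omega))
    have h := ih.mul ((((E (2 * k + 1)).pow 2).mul (E (4 * k + 2))).div
      ((E (4 * k + 4)).pow 3) hne)
    have hk : (k + 1 : ℂ) ≠ 0 := by exact_mod_cast k.succ_ne_zero
    have e : (binomWeight k : ℂ) * (((2 * k + 1 : ℕ) : ℂ) ^ 2 * ((4 * k + 2 : ℕ) : ℂ)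
        / ((4 * k + 4 : ℕ) : ℂ) ^ 3) = (binomWeight (k + 1) : ℂ) := by
      rw [binomWeight_succ]
      push_cast
      rw [show (4 * (k : ℂ) + 4) = 4 * (k + 1) by ring]
      field_simp
      ring
    rw [e] at h
    refine h.congr' ?_
    filter_upwards [self_mem_nhdsWithin] with q hq
    have hq' : 1 - q ≠ 0 := sub_ne_zero.2 (Ne.symm hq)
    rw [qFactor_succ]
    simp only [Pi.div_apply, div_pow]
    field_simp

theorem tendsto_qWeight (k : ℕ) :
    Tendsto (fun q : ℂ => qWeight q k) (𝓝[≠] 1) (𝓝 (binomWeight k : ℂ)) := by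
  have h : Tendsto (fun q : ℂ => q ^ k ^ 2) (𝓝[≠] 1) (𝓝 1) := by
    simpa using ((continuous_pow (M := ℂ) (k ^ 2)).tendsto 1).mono_left
      (nhdsWithin_le_nhds (s := {1}ᶜ))
  simpa [qWeight] using h.mul (tendsto_qFactor k)

theorem tendsto_zpow_nhdsNE_one (n : ℤ) :
    Tendsto (fun q : ℂ => q ^ n) (𝓝[≠] 1) (𝓝 1) := by
  simpa using (continuousAt_zpow₀ (1 : ℂ) n (Or.inl one_ne_zero)).tendsto.mono_left
    (nhdsWithin_le_nhds (s := {1}ᶜ))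

theorem two_mul_sub_one_ne_zero (k : ℕ) : (2 * k - 1 : ℝ) ≠ 0 := by
  have : (2 * k - 1 : ℤ) ≠ 0 := by omega
  exact_mod_cast this

theorem tendsto_qTerm₁ (k : ℕ) :
    Tendsto (fun q : ℝ => qTerm₁ (q : ℂ) k) (𝓝[<] 1) (𝓝 (((-1) * sunTerm₁ k : ℝ) : ℂ)) := by
  refine Tendsto.comp (g := fun q : ℂ => qTerm₁ q k) ?_ tendsto_ofReal_nhdsLT_one
  have hk : (2 * k - 1 : ℂ) ≠ 0 := by exact_mod_cast two_mul_sub_one_ne_zero k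
  have e2 : ((4 * (k : ℤ) - 2 : ℤ) : ℂ) = 2 * (2 * k - 1) := by push_cast; ring
  have e1 : ((2 * (k : ℤ) - 1 : ℤ) : ℂ) = 2 * k - 1 := by push_cast; ring
  have h := (((tendsto_numP₁_div k).mul (tendsto_zpow_nhdsNE_one ((k : ℤ) ^ 2 - 4))).div
    ((tendsto_qNum (2 * k - 1)).mul (tendsto_qNum (4 * k - 2)))
    (by rw [e1, e2]; exact mul_ne_zero hk (mul_ne_zero two_ne_zero hk))).mul (tendsto_qFactor k)
  have e : (2 - 24 * (k : ℂ) ^ 2) * 1 / (((2 * (k : ℤ) - 1 : ℤ) : ℂ) *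
      ((4 * (k : ℤ) - 2 : ℤ) : ℂ)) * (binomWeight k : ℂ) = (((-1) * sunTerm₁ k : ℝ) : ℂ) := by
    rw [e1, e2, binomWeight, sunTerm₁]
    push_cast
    field_simp
    ring
  rw [e] at h
  refine h.congr fun q => ?_
  simp only [qTerm₁, Pi.div_apply, div_eq_mul_inv, mul_inv]
  ring

theorem tendsto_qTerm₂ (k : ℕ) :
    Tendsto (fun q : ℝ => qTerm₂ (q : ℂ) k) (𝓝[<] 1) (𝓝 ((4 * sunTerm₂ k : ℝ) : ℂ)) := by
  refine Tendsto.comp (g := fun q : ℂ => qTerm₂ q k) ?_ tendsto_ofReal_nhdsLT_one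
  have hk : (2 * k - 1 : ℂ) ≠ 0 := by exact_mod_cast two_mul_sub_one_ne_zero k
  have e2 : ((4 * (k : ℤ) - 2 : ℤ) : ℂ) = 2 * (2 * k - 1) := by push_cast; ring
  have e1 : ((2 * (k : ℤ) - 1 : ℤ) : ℂ) = 2 * k - 1 := by push_cast; ring
  have hadd : Tendsto (fun q : ℂ => 1 + q) (𝓝[≠] 1) (𝓝 (1 + 1)) :=
    ((continuous_const.add continuous_id).tendsto 1).mono_left nhdsWithin_le_nhds
  have h := ((((tendsto_numP₂_div k).mul (tendsto_zpow_nhdsNE_one ((k : ℤ) ^ 2 - 7))).mul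
    hadd).div (((tendsto_qNum (2 * k - 1)).pow 2).mul (tendsto_qNum (4 * k - 2)))
    (by rw [e1, e2]; exact mul_ne_zero (pow_ne_zero _ hk) (mul_ne_zero two_ne_zero hk))).mul
    (tendsto_qFactor k)
  have e : (4 * (k : ℂ) * (6 * k - 1)) * 1 * (1 + 1) / (((2 * (k : ℤ) - 1 : ℤ) : ℂ) ^ 2 *
      ((4 * (k : ℤ) - 2 : ℤ) : ℂ)) * (binomWeight k : ℂ) = ((4 * sunTerm₂ k : ℝ) : ℂ) := by
    rw [e1, e2, binomWeight, sunTerm₂]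
    push_cast
    field_simp
    ring
  rw [e] at h
  refine h.congr fun q => ?_
  simp only [qTerm₂, Pi.div_apply, div_eq_mul_inv, mul_inv]
  ring

/-! ### The limit of the sum -/

/-- The inequality `n q^(n-1) ≤ 1 + q² + ⋯ + q^(2(n-1))` of arithmetic and geometric means,
multiplied by `1 - q²`. -/
theorem succ_mul_pow_mul_le {q : ℝ} (h0 : 0 ≤ q) (h1 : q ≤ 1) (n : ℕ) :
    (n + 1) * q ^ n * (1 - q ^ 2) ≤ 1 - q ^ (2 * (n + 1)) := by
  induction n with
  | zero => simp
  | succ n ih =>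
    have hb := one_add_mul_le_pow (a := q - 1) (by linarith) (n + 1)
    rw [add_sub_cancel] at hb
    have hq : 0 ≤ 1 - q ^ 2 := by nlinarith
    have hn : 0 ≤ q ^ n := pow_nonneg h0 n
    have hstep : (n + 2) * q ^ (n + 1) ≤ (n + 1) * q ^ n + q ^ (2 * (n + 1)) := by
      have h2 : q ^ (n + 1) ≤ q ^ n := pow_le_pow_of_le_one h0 h1 n.le_succ
      have h3 : q ^ (n + 1) * (1 - q ^ (n + 1)) ≤ q ^ n * ((n + 1) * (1 - q)) := by
        refine mul_le_mul h2 ?_ (sub_nonneg.2 (pow_le_one₀ h0 h1)) hn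
        push_cast at hb
        linarith
      have e : q ^ (2 * (n + 1)) = q ^ (n + 1) * q ^ (n + 1) := by ring
      have e' : q ^ (n + 1) = q ^ n * q := pow_succ q n
      rw [e]
      nlinarith
    have h4 := mul_le_mul_of_nonneg_right hstep hq
    have e : q ^ (2 * (n + 1 + 1)) = q ^ (2 * (n + 1)) * q ^ 2 := by ring
    rw [e]
    push_cast
    nlinarith

/-- `1 - q^(4i+2) (1-q²)² / (1-q^(4i+4))²` is the quotient of the `i`-th factors of
`(q²; q⁴)_∞ (q⁶; q⁴)_∞` and `(q⁴; q⁴)_∞²`; this is the subtracted part, with its sign. -/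
noncomputable def wallisTerm (q : ℂ) (i : ℕ) : ℂ :=
  -(q ^ (4 * i + 2) * ((1 - q ^ 2) / (1 - q ^ (4 * i + 4))) ^ 2)

theorem norm_wallisTerm_le {q : ℝ} (h0 : 0 ≤ q) (h1 : q < 1) (i : ℕ) :
    ‖wallisTerm q i‖ ≤ 1 / ((i : ℝ) + 1) ^ 2 := by
  have hd : 0 < 1 - q ^ (4 * i + 4) := sub_pos.2 (pow_lt_one₀ h0 h1 (by omega))
  have hq : 0 ≤ 1 - q ^ 2 := sub_nonneg.2 (pow_le_one₀ h0 h1.le)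
  have e : wallisTerm q i = ((-(q ^ (2 * i + 1) * ((1 - q ^ 2) / (1 - q ^ (4 * i + 4)))) ^ 2
      : ℝ) : ℂ) := by
    rw [wallisTerm]
    push_cast
    ring
  have h := succ_mul_pow_mul_le h0 h1.le (2 * i + 1)
  rw [show 2 * (2 * i + 1 + 1) = 4 * i + 4 by ring] at h
  push_cast at h
  have hp : 0 ≤ q ^ (2 * i + 1) * (1 - q ^ 2) := mul_nonneg (pow_nonneg h0 _) hq
  rw [e, Complex.norm_real, norm_neg, norm_pow, ← one_div_pow, ← mul_div_assoc]
  refine pow_le_pow_left₀ (norm_nonneg _) ?_ 2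
  rw [Real.norm_of_nonneg (div_nonneg hp hd.le), div_le_div_iff₀ hd (by positivity)]
  have hi : (0 : ℝ) ≤ i := i.cast_nonneg
  nlinarith

theorem summable_one_div_succ_sq : Summable fun i : ℕ => 1 / ((i : ℝ) + 1) ^ 2 := by
  have h := (summable_nat_add_iff 1).2 (Real.summable_one_div_nat_pow.2 one_lt_two)
  simpa using h

theorem qSum_eq_tprod {q : ℝ} (h0 : 0 ≤ q) (h1 : q < 1) :
    qSum q = ∏' i, (1 + wallisTerm q i) := by
  have hq : ‖(q : ℂ)‖ < 1 := by rwa [Complex.norm_real, Real.norm_of_nonneg h0]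
  have h4 : ‖(q : ℂ) ^ 4‖ < 1 := (norm_pow_le_self hq four_ne_zero).trans_lt hq
  have hm : Multipliable fun i => 1 + wallisTerm q i := multipliable_one_add_of_summable
    (summable_one_div_succ_sq.of_nonneg_of_le (fun _ => norm_nonneg _) (norm_wallisTerm_le h0 h1))
  refine tendsto_nhds_unique (((tendsto_qPoch _ h4).mul (tendsto_qPoch _ h4)).div
    ((tendsto_qPoch _ h4).pow 2) (pow_ne_zero _ (qPochInf_ne_zero h4 h4)))
    (hm.tendsto_prod_tprod_nat.congr fun n => ?_)
  simp only [Pi.div_apply, qPoch, ← Finset.prod_mul_distrib, ← Finset.prod_pow,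
    ← Finset.prod_div_distrib]
  refine Finset.prod_congr rfl fun i _ => ?_
  have hne := one_sub_pow_ne_zero hq (n := 4 * i + 4) (by omega)
  rw [wallisTerm, show (q : ℂ) ^ 4 * (q ^ 4) ^ i = q ^ (4 * i + 4) by ring]
  field_simp
  ring

theorem tprod_wallis : ∏' i : ℕ, (1 + -((1 : ℂ) / 2) ^ 2 / ((i : ℂ) + 1) ^ 2) = 2 / (Real.pi : ℂ) := by
  have hs : Summable fun i : ℕ => ‖-((1 : ℂ) / 2) ^ 2 / ((i : ℂ) + 1) ^ 2‖ := by
    refine (summable_one_div_succ_sq.mul_left ((1 / 2) ^ 2)).congr fun i => ?_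
    rw [norm_div, norm_neg, norm_pow, norm_pow, ← Nat.cast_succ (R := ℂ), Complex.norm_natCast]
    simp
    ring
  have h1 := (multipliable_one_add_of_summable hs).tendsto_prod_tprod_nat
  have h2 := Complex.tendsto_euler_sin_prod (1 / 2)
  have hpi : (Real.pi : ℂ) ≠ 0 := by exact_mod_cast Real.pi_ne_zero
  rw [mul_one_div, Complex.sin_pi_div_two] at h2
  have h3 := tendsto_nhds_unique (h1.const_mul (Real.pi / 2 : ℂ)) (h2.congr fun n => by
    simp only [sub_eq_add_neg, neg_div])
  rw [eq_div_iff hpi]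
  linear_combination 2 * h3

theorem tendsto_qSum :
    Tendsto (fun q : ℝ => qSum (q : ℂ)) (𝓝[<] 1) (𝓝 ((2 / Real.pi : ℝ) : ℂ)) := by
  have hev : ∀ᶠ q : ℝ in 𝓝[<] 1, 0 ≤ q ∧ q < 1 := by
    filter_upwards [Ico_mem_nhdsLT (zero_lt_one (α := ℝ))] with q hq using hq
  have hlim : ∀ i : ℕ, Tendsto (fun q : ℝ => wallisTerm q i) (𝓝[<] 1)
      (𝓝 (-((1 : ℂ) / 2) ^ 2 / (i + 1) ^ 2)) := by
    intro i
    refine Tendsto.comp (g := fun q : ℂ => wallisTerm q i) ?_ tendsto_ofReal_nhdsLT_one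
    have hi : ((4 * i + 4 : ℕ) : ℂ) ≠ 0 := Nat.cast_ne_zero.2 (by omega)
    have hi' : (i + 1 : ℂ) ≠ 0 := by exact_mod_cast i.succ_ne_zero
    have h := ((tendsto_zpow_nhdsNE_one (4 * i + 2 : ℕ)).mul
      (((tendsto_one_sub_pow_div 2).div (tendsto_one_sub_pow_div (4 * i + 4)) hi).pow 2)).neg
    have e : -(1 * (((2 : ℕ) : ℂ) / ((4 * i + 4 : ℕ) : ℂ)) ^ 2)
        = -((1 : ℂ) / 2) ^ 2 / (i + 1) ^ 2 := by
      push_cast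
      rw [show (4 * (i : ℂ) + 4) = 4 * (i + 1) by ring]
      field_simp
      ring
    rw [e] at h
    refine h.congr' ?_
    filter_upwards [self_mem_nhdsWithin] with q hq
    have hq' : 1 - q ≠ 0 := sub_ne_zero.2 (Ne.symm hq)
    rw [wallisTerm, zpow_natCast, Pi.div_apply, div_div_div_cancel_right₀ hq']
  have h := tendsto_tprod_one_add_of_dominated_convergence summable_one_div_succ_sq hlim
    (hev.mono fun q hq i => norm_wallisTerm_le hq.1 hq.2 i)
  rw [tprod_wallis] at h
  push_cast
  exact h.congr' (hev.mono fun q hq => (qSum_eq_tprod hq.1 hq.2).symm)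

/-! ### Ramanujan's and Sun's series -/

/-- A bound uniform in `q`, from `u (1-u)² (1-u²) / (1-v²)³ ≤ u / (1+v)² ≤ 4/9` for `u = q^(2k+1)`
and `v = q^(2k+2) ≥ u/2`. -/
theorem norm_qWeight_le {q : ℝ} (h0 : 1 / 2 ≤ q) (h1 : q < 1) (k : ℕ) :
    ‖qWeight q k‖ ≤ (4 / 9) ^ k := by
  induction k with
  | zero => simp [qWeight, qFactor, qPoch]
  | succ k ih =>
    rw [qWeight_succ, norm_mul, pow_succ (4 / 9 : ℝ)]
    refine mul_le_mul ih ?_ (norm_nonneg _) (by positivity)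
    have hq0 : 0 < q := by linarith
    set u := q ^ (2 * k + 1) with hu
    have hu0 : 0 < u := pow_pos hq0 _
    have hu1 : u < 1 := pow_lt_one₀ hq0.le h1 (by omega)
    have hv0 : 0 < q * u := mul_pos hq0 hu0
    have hvu : q * u < u := by nlinarith
    have hv : u / 2 ≤ q * u := by nlinarith
    have e : (q : ℂ) ^ (2 * k + 1) * ((1 - (q : ℂ) ^ (2 * k + 1)) ^ 2 * (1 - (q : ℂ) ^ (4 * k + 2))
        / (1 - (q : ℂ) ^ (4 * k + 4)) ^ 3)
        = ((u * ((1 - u) ^ 2 * (1 - u ^ 2) / (1 - (q * u) ^ 2) ^ 3) : ℝ) : ℂ) := by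
      rw [hu]
      push_cast
      ring
    rw [e, Complex.norm_real]
    set v := q * u
    have hd : 0 < 1 - v ^ 2 := by nlinarith
    have hn : 0 ≤ 1 - u ^ 2 := by nlinarith
    rw [Real.norm_of_nonneg (by have := sub_nonneg.2 hu1.le; positivity), ← mul_div_assoc,
      div_le_iff₀ (by positivity)]
    -- since `u ≥ v`, both `1 - u` and `1 - u²` increase when `u` is replaced by `v`
    have h2 : (1 - u) ^ 2 * (1 - u ^ 2) ≤ (1 - v) ^ 2 * (1 - v ^ 2) := by
      have := sub_nonneg.2 hu1.le
      gcongr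
    have h3 : u ≤ 4 / 9 * (1 + v) ^ 2 := by nlinarith
    calc u * ((1 - u) ^ 2 * (1 - u ^ 2)) ≤ 4 / 9 * (1 + v) ^ 2 * ((1 - v) ^ 2 * (1 - v ^ 2)) := by
          gcongr
      _ = 4 / 9 * (1 - v ^ 2) ^ 3 := by ring

theorem norm_one_sub_pow_div_le {q : ℝ} (h0 : 0 ≤ q) (h1 : q < 1) (m : ℕ) :
    ‖(1 - (q : ℂ) ^ m) / (1 - (q : ℂ) ^ 2)‖ ≤ m := by
  have hb := one_add_mul_le_pow (a := q - 1) (by linarith) m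
  rw [add_sub_cancel] at hb
  have hd : 1 - q ≤ 1 - q ^ 2 := by nlinarith
  have hd' : 0 < 1 - q := sub_pos.2 h1
  have hn : 0 ≤ 1 - q ^ m := sub_nonneg.2 (pow_le_one₀ h0 h1.le)
  rw [show (1 - (q : ℂ) ^ m) / (1 - (q : ℂ) ^ 2) = (((1 - q ^ m) / (1 - q ^ 2) : ℝ) : ℂ) by
    push_cast; rfl, Complex.norm_real, Real.norm_of_nonneg (div_nonneg hn (hd'.le.trans hd)),
    div_le_iff₀ (hd'.trans_le hd)]
  have := mul_le_mul_of_nonneg_left hd m.cast_nonneg (α := ℝ)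
  linarith

theorem summable_natPow_mul_geometric (m : ℕ) {r : ℝ} (h0 : 0 ≤ r) (h1 : r < 1) :
    Summable fun k : ℕ => (k : ℝ) ^ m * r ^ k :=
  summable_pow_mul_geometric_of_norm_lt_one m (by rwa [Real.norm_of_nonneg h0])

theorem binomWeight_nonneg (k : ℕ) : 0 ≤ binomWeight k := by
  unfold binomWeight
  positivity

theorem binomWeight_le (k : ℕ) : binomWeight k ≤ (1 / 4) ^ k := by
  have h : ((2 * k).choose k : ℝ) ≤ 4 ^ k := by
    rw [← Nat.centralBinom_eq_two_mul_choose]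
    exact_mod_cast Nat.centralBinom_le_four_pow k
  calc binomWeight k ≤ (4 ^ k) ^ 3 / 256 ^ k := by unfold binomWeight; gcongr
    _ = (1 / 4) ^ k := by
      rw [← pow_mul, mul_comm, pow_mul, ← div_pow]
      norm_num

theorem summable_mul_binomWeight {R : ℕ → ℝ} {C : ℝ} {m : ℕ}
    (hR : ∀ k, |R k| ≤ C * (k : ℝ) ^ m) : Summable fun k => R k * binomWeight k := by
  refine Summable.of_norm_bounded ((summable_natPow_mul_geometric m (r := 1 / 4) (by norm_num)
    (by norm_num)).mul_left C) fun k => ?_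
  rw [norm_mul, Real.norm_eq_abs, Real.norm_of_nonneg (binomWeight_nonneg k), ← mul_assoc]
  exact mul_le_mul (hR k) (binomWeight_le k) (binomWeight_nonneg k) ((abs_nonneg _).trans (hR k))

/-- Ramanujan's series `∑ (6k+1) binom(2k,k)³ / 256^k = 4/π`, halved. -/
theorem hasSum_ramanujan :
    HasSum (fun k : ℕ => (6 * (k : ℝ) + 1) / 2 * binomWeight k) (2 / Real.pi) := by
  have hbound : Summable fun k : ℕ => (6 * (k : ℝ) + 1) * (4 / 9) ^ k := by
    have h1 := (summable_natPow_mul_geometric 1 (r := 4 / 9) (by norm_num)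
      (by norm_num)).mul_left 6
    have h0 := summable_natPow_mul_geometric 0 (r := 4 / 9) (by norm_num) (by norm_num)
    refine (h1.add h0).congr fun k => ?_
    ring
  have hev : ∀ᶠ q : ℝ in 𝓝[<] 1, 1 / 2 ≤ q ∧ q < 1 := by
    filter_upwards [Ico_mem_nhdsLT (one_half_lt_one (α := ℝ))] with q hq using hq
  have hlim : ∀ k : ℕ, Tendsto
      (fun q : ℝ => (1 - (q : ℂ) ^ (6 * k + 1)) / (1 - (q : ℂ) ^ 2) * qWeight q k) (𝓝[<] 1)
      (𝓝 (((6 * (k : ℝ) + 1) / 2 * binomWeight k : ℝ) : ℂ)) := by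
    intro k
    refine Tendsto.comp (g := fun q : ℂ => (1 - q ^ (6 * k + 1)) / (1 - q ^ 2) * qWeight q k) ?_
      tendsto_ofReal_nhdsLT_one
    have h := ((tendsto_one_sub_pow_div (6 * k + 1)).div (tendsto_one_sub_pow_div 2)
      (by norm_num)).mul (tendsto_qWeight k)
    push_cast at h ⊢
    refine h.congr' ?_
    filter_upwards [self_mem_nhdsWithin] with q hq
    rw [Pi.div_apply, div_div_div_cancel_right₀ (sub_ne_zero.2 (Ne.symm hq))]
  have hdom : ∀ᶠ q : ℝ in 𝓝[<] 1, ∀ k : ℕ,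
      ‖(1 - (q : ℂ) ^ (6 * k + 1)) / (1 - (q : ℂ) ^ 2) * qWeight q k‖
        ≤ (6 * (k : ℝ) + 1) * (4 / 9) ^ k := by
    filter_upwards [hev] with q hq k
    rw [norm_mul]
    have h := norm_one_sub_pow_div_le (by linarith [hq.1]) hq.2 (6 * k + 1)
    push_cast at h
    exact mul_le_mul h (norm_qWeight_le hq.1 hq.2 k) (norm_nonneg _) (by positivity)
  have h := tendsto_tsum_of_dominated_convergence hbound hlim hdom
  have h' := tendsto_nhds_unique h (tendsto_qSum.congr' (hev.mono fun q hq => by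
    have h0 : (q : ℂ) ≠ 0 := by
      have : q ≠ 0 := by linarith [hq.1]
      exact_mod_cast this
    have h1 : ‖(q : ℂ)‖ < 1 := by
      rw [Complex.norm_real, Real.norm_of_nonneg (by linarith [hq.1])]
      exact hq.2
    exact (hasSum_qRamanujan h0 h1).tsum_eq.symm))
  rw [← Complex.ofReal_tsum] at h'
  rw [← Complex.ofReal_inj.1 h']
  refine Summable.hasSum (hbound.of_nonneg_of_le (fun k => ?_) fun k => ?_)
  · exact mul_nonneg (by positivity) (binomWeight_nonneg k)
  · have h1 : (1 / 4 : ℝ) ^ k ≤ (4 / 9) ^ k :=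
      pow_le_pow_left₀ (by norm_num) (by norm_num) k
    exact mul_le_mul (by have := k.cast_nonneg (α := ℝ); linarith) ((binomWeight_le k).trans h1)
      (binomWeight_nonneg k) (by positivity)

theorem hasSum_of_eq_ramanujan_add_sub {f R : ℕ → ℝ} {C : ℝ} {m : ℕ}
    (hR : ∀ k, |R k| ≤ C * (k : ℝ) ^ m) (hR0 : R 0 = 0)
    (hf : ∀ k : ℕ, f k = (6 * (k : ℝ) + 1) / 2 * binomWeight k
      + (R (k + 1) * binomWeight (k + 1) - R k * binomWeight k)) :
    HasSum f (2 / Real.pi) := by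
  have h := hasSum_ramanujan.add (hasSum_succ_sub (summable_mul_binomWeight hR))
  rw [hR0, zero_mul, neg_zero, add_zero] at h
  rwa [funext hf]

theorem one_le_abs_two_mul_sub_one (k : ℕ) : 1 ≤ |2 * (k : ℝ) - 1| := by
  have : (1 : ℤ) ≤ |2 * (k : ℤ) - 1| := by
    rw [le_abs]
    omega
  exact_mod_cast this

/-- The certificate is the limit of `qCert₁ q k` as `q → 1`. -/
theorem hasSum_sunTerm₁ : HasSum sunTerm₁ (-2 / Real.pi) := by
  have h : HasSum (fun k => -sunTerm₁ k) (2 / Real.pi) := by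
    refine hasSum_of_eq_ramanujan_add_sub
      (R := fun k => 16 * (k : ℝ) ^ 3 / (2 * (k : ℝ) - 1) ^ 2) (C := 16) (m := 3) (fun k => ?_)
      (by simp) fun k => ?_
    · rw [abs_div, abs_pow, abs_of_nonneg (by positivity)]
      exact div_le_self (by positivity) (one_le_pow₀ (one_le_abs_two_mul_sub_one k))
    · have h1 := two_mul_sub_one_ne_zero k
      have h2 : (2 * (k : ℝ) + 1) ≠ 0 := by positivity
      have h3 : ((k : ℝ) + 1) ≠ 0 := by positivity
      have e : sunTerm₁ k = (12 * (k : ℝ) ^ 2 - 1) / (2 * (k : ℝ) - 1) ^ 2 * binomWeight k := by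
        rw [sunTerm₁, binomWeight, div_mul_div_comm]
      rw [e, binomWeight_succ]
      push_cast
      rw [show 2 * ((k : ℝ) + 1) - 1 = 2 * k + 1 by ring]
      generalize binomWeight k = w
      rw [mul_comm 2 (k : ℝ)] at h1 ⊢
      field_simp
      ring
  have h' := h.neg
  simpa only [neg_neg, neg_div] using h'

/-- The certificate is the limit of `qCert₂ q k` as `q → 1`. -/
theorem hasSum_sunTerm₂ : HasSum sunTerm₂ (1 / (2 * Real.pi)) := by
  have h : HasSum (fun k => 4 * sunTerm₂ k) (2 / Real.pi) := by
    refine hasSum_of_eq_ramanujan_add_sub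
      (R := fun k => 16 * (k : ℝ) ^ 3 * (2 * k - 3) / (2 * (k : ℝ) - 1) ^ 3) (C := 48) (m := 3)
      (fun k => ?_) (by simp) fun k => ?_
    · have h1 := one_le_abs_two_mul_sub_one k
      have h2 : |2 * (k : ℝ) - 3| ≤ 3 * |2 * (k : ℝ) - 1| := by
        have := abs_sub (2 * (k : ℝ) - 1) 2
        rw [show 2 * (k : ℝ) - 1 - 2 = 2 * k - 3 by ring, abs_two] at this
        linarith
      rw [abs_div, abs_mul, abs_pow, abs_of_nonneg (by positivity : 0 ≤ 16 * (k : ℝ) ^ 3),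
        div_le_iff₀ (by positivity)]
      have h3 : |2 * (k : ℝ) - 1| ≤ |2 * (k : ℝ) - 1| ^ 3 := le_self_pow₀ h1 three_ne_zero
      calc 16 * (k : ℝ) ^ 3 * |2 * (k : ℝ) - 3|
          ≤ 16 * (k : ℝ) ^ 3 * (3 * |2 * (k : ℝ) - 1| ^ 3) := by
            gcongr
            linarith
        _ = 48 * (k : ℝ) ^ 3 * |2 * (k : ℝ) - 1| ^ 3 := by ring
    · have h1 := two_mul_sub_one_ne_zero k
      have h2 : (2 * (k : ℝ) + 1) ≠ 0 := by positivity
      have h3 : ((k : ℝ) + 1) ≠ 0 := by positivity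
      have e : sunTerm₂ k = k * (6 * (k : ℝ) - 1) / (2 * (k : ℝ) - 1) ^ 3 * binomWeight k := rfl
      rw [e, binomWeight_succ]
      push_cast
      rw [show 2 * ((k : ℝ) + 1) - 1 = 2 * k + 1 by ring]
      generalize binomWeight k = w
      rw [mul_comm 2 (k : ℝ)] at h1 ⊢
      field_simp
      ring
  have h' := h.mul_left (1 / 4)
  have hpi := Real.pi_ne_zero
  rw [show 1 / 4 * (2 / Real.pi) = 1 / (2 * Real.pi) by field_simp; norm_num] at h'
  exact h'.congr_fun fun k => by ring

/-- Both `q`-identities for all complex `q` with `0 < |q| < 1`, and the sense in which they are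
`q`-analogues of Sun's identities: as `q → 1⁻` along the reals, the summands tend to `-1`
(respectively `4`) times the summands of Sun's series, and the common right-hand side tends to
`2/π`, which is `-1` (respectively `4`) times the sum of Sun's series. -/
theorem mainTheorem7 :
    (∀ q : ℂ, q ≠ 0 → ‖q‖ < 1 →
      HasSum (fun k : ℕ => qTerm₁ q k) (qSum q) ∧
      HasSum (fun k : ℕ => qTerm₂ q k) (qSum q)) ∧
    (∀ k : ℕ, Tendsto (fun q : ℝ => qTerm₁ (q : ℂ) k) (𝓝[<] 1)
      (𝓝 (((-1) * sunTerm₁ k : ℝ) : ℂ))) ∧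
    (∀ k : ℕ, Tendsto (fun q : ℝ => qTerm₂ (q : ℂ) k) (𝓝[<] 1)
      (𝓝 ((4 * sunTerm₂ k : ℝ) : ℂ))) ∧
    Tendsto (fun q : ℝ => qSum (q : ℂ)) (𝓝[<] 1) (𝓝 ((2 / Real.pi : ℝ) : ℂ)) ∧
    HasSum sunTerm₁ (-2 / Real.pi) ∧
    HasSum sunTerm₂ (1 / (2 * Real.pi)) :=
  ⟨fun _ h0 hq => ⟨hasSum_qTerm₁ h0 hq, hasSum_qTerm₂ h0 hq⟩, tendsto_qTerm₁, tendsto_qTerm₂,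
    tendsto_qSum, hasSum_sunTerm₁, hasSum_sunTerm₂⟩
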